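/- **Proposition.** Let $k\ge 1$ be an integer, $p\in[0,1)$ and $b\in[1,\infty)$. Then there exist $\hat p\in[p,1)$, an infinite, locally finite tree $\mathbb T=(V,E)$ with branching number $b$, and a $k$-independent site percolation $Z=(Z_v)_{v\in V}$ on $\mathbb T$ with parameter $\hat p$ such that, for $q\in[0,1]$, $Z$ stochastically dominates the Bernoulli product field with parameter $q$ on $\{0,1\}^V$ (all sites independent and open with probability $q$) if and only if $q=0$. Here the branching number of a tree rooted at $o$ is the supremum of all $\lambda\ge 1$ for which there is a nonzero function $f:V\to[0,\infty)$ such that, for every $v\in V$, $f(v)=\sum_{w} f(w)\le\lambda^{-d(o,v)}$, where the sum runs over the children $w$ of $v$; it does not depend on the choice of the root $o$. A site percolation with parameter $\hat p$ is a random element $Z$ of $\{0,1\}^V$ with $\mathbb P(Z_v=1)=\hat p$ for all $v\in V$. It is $k$-independent if $(Z_v)_{v\in U}$ and $(Z_v)_{v\in W}$ are independent for all $U,W\subseteq V$ at graph distance $d(U,W)>k$. A random element $X$ of $\{0,1\}^V$ stochastically dominates $Y$ if there is a coupling of $X$ and $Y$ under which $X\ge Y$ coordinatewise almost surely. -/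

import Mathlib

open MeasureTheory ProbabilityTheory

namespace TreePercolation

/-- The children of the vertex `v` in the tree `G` rooted at `o`: the neighbours of `v` that lie one
level further away from the root. -/
def children {V : Type*} (G : SimpleGraph V) (o v : V) : Set V :=
  {w | G.Adj v w ∧ G.dist o w = G.dist o v + 1}

/-- A `lam`-flow on the tree `G` rooted at `o`: the nonnegative value at each vertex `v` is the sum
of the values at its children and is at most `lam ^ (-|v|)`, where `|v|` is the level of `v`. -/
def IsFlow {V : Type*} (G : SimpleGraph V) (o : V) (lam : ℝ) (f : V → ℝ) : Prop :=
  ∀ v, 0 ≤ f v ∧ HasSum (fun w : children G o v => f w) (f v) ∧ f v ≤ (lam ^ G.dist o v)⁻¹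

/-- `b` is the branching number of the tree `G` rooted at `o`, that is, the supremum of all
`lam ≥ 1` for which there is a nonzero `lam`-flow. -/
def IsBranchingNumber {V : Type*} (G : SimpleGraph V) (o : V) (b : ℝ) : Prop :=
  IsLUB {lam : ℝ | 1 ≤ lam ∧ ∃ f : V → ℝ, f ≠ 0 ∧ IsFlow G o lam f} b

/-- `Z` is a site percolation on the vertex set `V` (`true` means open) in which every single site
is open with probability `p`. -/
def IsSitePercolation {V Ω : Type*} [MeasurableSpace Ω] (P : Measure Ω) (Z : Ω → V → Bool)
    (p : ℝ) : Prop :=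
  Measurable Z ∧ ∀ v, P {ω | Z ω v = true} = ENNReal.ofReal p

/-- `k`-independence: the restrictions of `Z` to any two sets of vertices of graph distance greater
than `k` are independent. -/
def IsKIndependent {V Ω : Type*} [MeasurableSpace Ω] (G : SimpleGraph V) (k : ℕ) (P : Measure Ω)
    (Z : Ω → V → Bool) : Prop :=
  ∀ U W : Set V, (∀ u ∈ U, ∀ w ∈ W, k < G.dist u w) →
    IndepFun (fun ω (u : U) => Z ω u) (fun ω (w : W) => Z ω w) P

/-- The law `μ` on `{0,1}^V` stochastically dominates the law `ν`: there is a coupling of the two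
under which the first configuration is almost surely coordinatewise at least the second. -/
def StochDominates {V : Type*} (μ ν : Measure (V → Bool)) : Prop :=
  ∃ π : Measure ((V → Bool) × (V → Bool)),
    π.map Prod.fst = μ ∧ π.map Prod.snd = ν ∧ ∀ᵐ x ∂π, x.2 ≤ x.1

/-- The Bernoulli product field: all sites are independent and open with probability `q`. -/
noncomputable def bernoulliField (V : Type*) (q : unitInterval) : Measure (V → Bool) :=
  Measure.infinitePi fun _ : V => bernoulliMeasure true false q

end TreePercolation

/-!
The obstruction to domination is local. Let a vertex `c` have `m` neighbours, let all sites other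
than `c` be independent and open with probability `x`, and declare `c` open exactly when one of its
`m` neighbours is closed. Then `c` and its neighbours are never all open, whereas they are so with
positive probability under every Bernoulli field with positive parameter. The field is
`1`-independent, and `c` is open with probability `1 - x ^ m`, which equals `x` for a suitable `x`;
this `x` is as close to `1` as desired when `m` is large.

It remains to find a tree with branching number `b` and a vertex of large degree. The branching
number of a spherically symmetric tree is the exponential growth rate of its level sizes: the flow
that splits evenly at every vertex gives one inequality, and the conservation of a flow across
spheres the other. Level sizes of growth rate `b` are found greedily, starting with any degree `m`
of the root.
-/

namespace TreePercolation

open Asymptotics Filter Finset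

section Flow

variable {V : Type*} {G : SimpleGraph V} {o v w : V} {lam : ℝ} {f : V → ℝ}

lemma eq_of_mem_children (hG : G.IsTree) {x y : V} (hx : w ∈ children G o x)
    (hy : w ∈ children G o y) : x = y := by
  have isPath_concat {u : V} (hu : w ∈ children G o u) {q : G.Walk o u}
      (hq : q.length = G.dist o u) : (q.concat hu.1).IsPath :=
    SimpleGraph.Walk.isPath_of_length_eq_dist _ (by rw [q.length_concat, hq, hu.2])
  obtain ⟨q, hq⟩ := hG.connected.exists_walk_length_eq_dist o x
  obtain ⟨r, hr⟩ := hG.connected.exists_walk_length_eq_dist o y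
  have h := (hG.isAcyclic.subsingleton_path o w).elim
    ⟨_, isPath_concat hx hq⟩ ⟨_, isPath_concat hy hr⟩
  simpa only [SimpleGraph.Walk.penultimate_concat] using
    congrArg SimpleGraph.Walk.penultimate (congrArg Subtype.val h)

lemma exists_mem_children (hG : G.Connected) {n : ℕ} (hw : G.dist o w = n + 1) :
    ∃ v, G.dist o v = n ∧ w ∈ children G o v := by
  obtain ⟨q, hq⟩ := hG.exists_walk_length_eq_dist w o
  rw [SimpleGraph.dist_comm, hw] at hq
  cases q with
  | nil => simp at hq
  | @cons _ v _ hwv q =>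
    have hov : G.dist o v ≤ n := by
      rw [SimpleGraph.dist_comm]
      exact (SimpleGraph.dist_le q).trans (Nat.succ_le_succ_iff.1 hq.le)
    have hvw := SimpleGraph.dist_eq_one_iff_adj.2 hwv.symm
    have htri := hG.dist_triangle (u := o) (v := v) (w := w)
    exact ⟨v, by omega, hwv.symm, by omega⟩

lemma IsFlow.le_of_mem_children (hf : IsFlow G o lam f) (hw : w ∈ children G o v) : f w ≤ f v :=
  le_hasSum (hf v).2.1 ⟨w, hw⟩ fun u _ => (hf u).1

lemma IsFlow.le_root (hG : G.Connected) (hf : IsFlow G o lam f) (v : V) : f v ≤ f o := by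
  induction h : G.dist o v generalizing v with
  | zero => rw [hG.dist_eq_zero_iff.1 h]
  | succ n ih =>
    obtain ⟨u, hu, hv⟩ := exists_mem_children hG h
    exact (hf.le_of_mem_children hv).trans (ih u hu)

lemma IsFlow.eq_sum_children (hf : IsFlow G o lam f) (hfin : (children G o v).Finite) :
    f v = ∑ w ∈ hfin.toFinset, f w := by
  have h : HasSum (fun w : (hfin.toFinset : Set V) => f w) (∑ w ∈ hfin.toFinset, f w) :=
    Finset.hasSum _ f
  rw [Set.Finite.coe_toFinset] at h
  exact (hf v).2.1.unique h

lemma IsFlow.root_eq_sum_sphere (hG : G.IsTree) (hf : IsFlow G o lam f)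
    (hfin : ∀ n, {v | G.dist o v = n}.Finite) (n : ℕ) :
    f o = ∑ v ∈ (hfin n).toFinset, f v := by
  classical
  have hch (v : V) : (children G o v).Finite := (hfin (G.dist o v + 1)).subset fun w hw => hw.2
  induction n with
  | zero =>
    have hsphere : (hfin 0).toFinset = {o} := by
      ext v
      simp only [Set.Finite.mem_toFinset, Set.mem_ofPred_eq, hG.connected.dist_eq_zero_iff,
        mem_singleton, eq_comm]
    rw [hsphere, sum_singleton]
  | succ n ih =>
    have hsphere : (hfin (n + 1)).toFinset =
        (hfin n).toFinset.biUnion fun v => (hch v).toFinset := by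
      ext w
      simp only [mem_biUnion, Set.Finite.mem_toFinset, Set.mem_ofPred_eq]
      refine ⟨exists_mem_children hG.connected, ?_⟩
      rintro ⟨v, hv, hw⟩
      rw [hw.2, hv]
    rw [ih, hsphere, sum_biUnion]
    · exact sum_congr rfl fun v _ => hf.eq_sum_children (hch v)
    · intro x _ y _ hxy
      refine disjoint_left.2 fun w hx hy => hxy ?_
      exact eq_of_mem_children hG ((hch x).mem_toFinset.1 hx) ((hch y).mem_toFinset.1 hy)

lemma IsFlow.root_le_ncard_sphere_mul (hG : G.IsTree) (hf : IsFlow G o lam f)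
    (hfin : ∀ n, {v | G.dist o v = n}.Finite) (n : ℕ) :
    f o ≤ {v | G.dist o v = n}.ncard * (lam ^ n)⁻¹ := by
  rw [hf.root_eq_sum_sphere hG hfin n, Set.ncard_eq_toFinset_card _ (hfin n), ← nsmul_eq_mul]
  refine sum_le_card_nsmul _ _ _ fun v hv => ?_
  have hv' : G.dist o v = n := (hfin n).mem_toFinset.1 hv
  exact hv' ▸ (hf v).2.2

lemma IsFlow.eq_zero_of_ncard_sphere_le (hG : G.IsTree) (hf : IsFlow G o lam f)
    (hfin : ∀ n, {v | G.dist o v = n}.Finite) {C r : ℝ} (hr : 0 ≤ r) (hlam : r < lam)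
    (hcard : ∀ n, {v | G.dist o v = n}.ncard ≤ C * r ^ n) : f = 0 := by
  have hlam0 : 0 < lam := hr.trans_lt hlam
  have hbound (n : ℕ) : f o ≤ C * (r / lam) ^ n := by
    calc f o ≤ {v | G.dist o v = n}.ncard * (lam ^ n)⁻¹ := hf.root_le_ncard_sphere_mul hG hfin n
      _ ≤ C * r ^ n * (lam ^ n)⁻¹ := by gcongr; exact hcard n
      _ = C * (r / lam) ^ n := by rw [div_pow, mul_assoc, div_eq_mul_inv]
  have hlim : Tendsto (fun n : ℕ => C * (r / lam) ^ n) atTop (nhds 0) := by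
    simpa using (tendsto_pow_atTop_nhds_zero_of_lt_one (div_nonneg hr hlam0.le)
      ((div_lt_one hlam0).2 hlam)).const_mul C
  have hroot : f o ≤ 0 := ge_of_tendsto' hlim hbound
  ext v
  exact le_antisymm ((hf.le_root hG.connected v).trans hroot) (hf v).1

end Flow

section Height

variable {V : Type*} {G : SimpleGraph V}

-- On a cycle, a vertex of maximal height would have two distinct neighbours that are not higher.
lemma isAcyclic_of_height {α : Type*} [LinearOrder α] (h : V → α)
    (huniq : ∀ u v w, G.Adj u v → G.Adj u w → h v ≤ h u → h w ≤ h u → v = w) : G.IsAcyclic := by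
  classical
  intro v p hp
  obtain ⟨u, hu, hmax⟩ := p.support.toFinset.exists_max_image h ⟨v, by simp⟩
  rw [List.mem_toFinset] at hu
  have hle (i : ℕ) : h ((p.rotate u hu).getVert i) ≤ h u :=
    hmax _ <| List.mem_toFinset.2 <|
      (p.mem_support_rotate_iff u hu).1 <| SimpleGraph.Walk.getVert_mem_support _ i
  have hr := hp.rotate hu
  exact hr.snd_ne_penultimate (huniq u _ _ (SimpleGraph.Walk.adj_snd hr.not_nil)
    (SimpleGraph.Walk.adj_penultimate hr.not_nil).symm (hle _) (hle _))

lemma height_le_add_dist (hG : G.Connected) {h : V → ℕ} (hadj : ∀ u v, G.Adj u v → h v ≤ h u + 1)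
    (u v : V) : h v ≤ h u + G.dist u v := by
  obtain ⟨p, hp⟩ := hG.exists_walk_length_eq_dist u v
  rw [← hp]
  clear hp
  induction p with
  | nil => simp
  | cons huw p ih =>
    have := hadj _ _ huw
    rw [SimpleGraph.Walk.length_cons]
    omega

end Height

section SphericallySymmetric

/-- The vertices of the spherically symmetric tree in which every vertex on level `i` has `d i`
children: a vertex on level `n` is encoded by the `n` choices of a child that lead to it from the
root. -/
abbrev Vertex (d : ℕ → ℕ) : Type := Σ n, ∀ i : Fin n, Fin (d i)

variable {d : ℕ → ℕ} {o u v w : Vertex d}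

/-- The root of the spherically symmetric tree, the only vertex on level `0`. -/
def root (d : ℕ → ℕ) : Vertex d := ⟨0, fun i => i.elim0⟩

/-- The `j`-th child of the vertex `v` of the spherically symmetric tree. -/
def child (v : Vertex d) (j : Fin (d v.1)) : Vertex d :=
  ⟨v.1 + 1, Fin.snoc (α := fun i => Fin (d i)) v.2 j⟩

/-- The parent of a vertex of the spherically symmetric tree; the root is its own parent. -/
def parent : Vertex d → Vertex d
  | ⟨0, x⟩ => ⟨0, x⟩
  | ⟨n + 1, x⟩ => ⟨n, Fin.init x⟩

lemma parent_child (v : Vertex d) (j : Fin (d v.1)) : parent (child v j) = v := by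
  simp only [child, parent, Fin.init_snoc]

lemma child_injective (v : Vertex d) : Function.Injective (child v) := fun _ _ h =>
  Fin.snoc_right_injective (α := fun i => Fin (d i)) v.2 (eq_of_heq (Sigma.mk.inj h).2)

lemma eq_root_or_exists_eq_child (v : Vertex d) : v = root d ∨ ∃ u j, v = child u j := by
  obtain ⟨n, x⟩ := v
  cases n with
  | zero => exact Or.inl (congrArg (Sigma.mk 0) (Subsingleton.elim _ _))
  | succ n =>
    exact Or.inr ⟨⟨n, Fin.init x⟩, x (Fin.last n), by simp only [child, Fin.snoc_init_self]⟩

/-- The relation "`w` is a child of `v`" of the spherically symmetric tree, which is `children` for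
the distinguished root. -/
def IsChild (v w : Vertex d) : Prop := ∃ j, w = child v j

lemma IsChild.level_eq (h : IsChild v w) : w.1 = v.1 + 1 := by
  obtain ⟨j, rfl⟩ := h
  rfl

lemma IsChild.parent_eq (h : IsChild v w) : parent w = v := by
  obtain ⟨j, rfl⟩ := h
  exact parent_child v j

/-- The spherically symmetric tree in which every vertex on level `i` has `d i` children. -/
def symTree (d : ℕ → ℕ) : SimpleGraph (Vertex d) where
  Adj v w := IsChild v w ∨ IsChild w v
  symm := ⟨fun _ _ h => h.symm⟩
  loopless := ⟨fun v h => by rcases h with h | h <;> exact absurd h.level_eq (by omega)⟩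

lemma symTree_reachable_root (v : Vertex d) : (symTree d).Reachable (root d) v := by
  induction h : v.1 generalizing v with
  | zero =>
    rcases eq_root_or_exists_eq_child v with rfl | ⟨u, j, rfl⟩
    · rfl
    · exact absurd h (Nat.succ_ne_zero _)
  | succ n ih =>
    rcases eq_root_or_exists_eq_child v with rfl | ⟨u, j, rfl⟩
    · rfl
    · have hadj : (symTree d).Adj u (child u j) := Or.inl ⟨j, rfl⟩
      exact (ih u (Nat.succ.inj h)).trans hadj.reachable

lemma symTree_connected : (symTree d).Connected where
  preconnected u v := (symTree_reachable_root u).symm.trans (symTree_reachable_root v)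
  nonempty := ⟨root d⟩

lemma symTree_isAcyclic : (symTree d).IsAcyclic := by
  refine isAcyclic_of_height Sigma.fst fun u v w huv huw hv hw => ?_
  have isChild_of_le {x : Vertex d} (hux : (symTree d).Adj u x) (hx : x.1 ≤ u.1) :
      IsChild x u :=
    hux.resolve_left fun h => by have := h.level_eq; omega
  rw [← (isChild_of_le huv hv).parent_eq, ← (isChild_of_le huw hw).parent_eq]

lemma symTree_isTree : (symTree d).IsTree := ⟨symTree_connected, symTree_isAcyclic⟩

lemma level_le_of_symTree_adj (h : (symTree d).Adj u v) : v.1 ≤ u.1 + 1 := by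
  rcases h with h | h <;> have := h.level_eq <;> omega

lemma level_le_add_dist (u v : Vertex d) : v.1 ≤ u.1 + (symTree d).dist u v :=
  height_le_add_dist symTree_connected (fun _ _ => level_le_of_symTree_adj) u v

/-- The number of vertices on level `n` of the spherically symmetric tree. -/
def levelSize (d : ℕ → ℕ) (n : ℕ) : ℕ := ∏ i ∈ range n, d i

lemma levelSize_succ (d : ℕ → ℕ) (n : ℕ) : levelSize d (n + 1) = levelSize d n * d n :=
  prod_range_succ d n

lemma levelSize_ne_zero (hd : ∀ n, d n ≠ 0) (n : ℕ) : levelSize d n ≠ 0 :=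
  prod_ne_zero_iff.2 fun i _ => hd i

/-- The ball of radius `n` around the root of the spherically symmetric tree. -/
def levelsUpTo (d : ℕ → ℕ) (n : ℕ) : Finset (Vertex d) := (range (n + 1)).sigma fun _ => univ

lemma mem_levelsUpTo {n : ℕ} : v ∈ levelsUpTo d n ↔ v.1 ≤ n := by
  simp [levelsUpTo]

lemma card_levelsUpTo (n : ℕ) : #(levelsUpTo d n) = ∑ j ∈ range (n + 1), levelSize d j := by
  simp only [levelsUpTo, card_sigma, card_univ, Fintype.card_pi, Fintype.card_fin, levelSize,
    prod_range]

lemma symTree_neighborSet_finite (v : Vertex d) : ((symTree d).neighborSet v).Finite :=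
  (levelsUpTo d (v.1 + 1)).finite_toSet.subset fun _ hw =>
    mem_levelsUpTo.2 (level_le_of_symTree_adj hw)

lemma sphere_subset_levelsUpTo (o : Vertex d) (n : ℕ) :
    {v | (symTree d).dist o v = n} ⊆ (levelsUpTo d (o.1 + n) : Set (Vertex d)) := by
  rintro v rfl
  exact mem_levelsUpTo.2 (level_le_add_dist o v)

lemma infinite_vertex (hd : ∀ n, d n ≠ 0) : Infinite (Vertex d) :=
  Infinite.of_injective (fun n => (⟨n, fun i => ⟨0, Nat.pos_of_ne_zero (hd i)⟩⟩ : Vertex d))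
    fun _ _ h => congrArg Sigma.fst h

lemma ncard_neighborSet_root (d : ℕ → ℕ) : ((symTree d).neighborSet (root d)).ncard = d 0 := by
  have hrange : (symTree d).neighborSet (root d) = Set.range (child (root d)) := by
    ext w
    refine ⟨?_, fun ⟨j, hj⟩ => Or.inl ⟨j, hj.symm⟩⟩
    rintro (⟨j, rfl⟩ | h)
    · exact ⟨j, rfl⟩
    · exact absurd h.level_eq.symm (Nat.succ_ne_zero _)
  rw [hrange, Set.ncard_range_of_injective (child_injective _), Nat.card_fin]
  rfl

/-- `v` is a descendant of `o`, or `o` itself, in the spherically symmetric tree with its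
distinguished root. -/
abbrev IsDescendant (o v : Vertex d) : Prop := Relation.ReflTransGen IsChild o v

lemma IsDescendant.dist_add (h : IsDescendant o v) : (symTree d).dist o v + o.1 = v.1 := by
  refine le_antisymm ?_ (by have := level_le_add_dist o v; omega)
  induction h with
  | refl => simp
  | @tail u w _ huw ih =>
    have htri := symTree_connected.dist_triangle (u := o) (v := u) (w := w)
    have hadj : (symTree d).dist u w = 1 := SimpleGraph.dist_eq_one_iff_adj.2 (Or.inl huw)
    have := huw.level_eq
    omega

lemma IsDescendant.of_isChild (h : IsDescendant o w) (hw : IsChild v w) (hne : w ≠ o) :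
    IsDescendant o v := by
  rcases Relation.ReflTransGen.cases_tail h with rfl | ⟨u, hu, huw⟩
  · exact absurd rfl hne
  · rwa [← hw.parent_eq, huw.parent_eq]

lemma IsDescendant.of_mem_children (h : IsDescendant o w) (hw : w ∈ children (symTree d) o v) :
    IsDescendant o v := by
  rcases hw.1 with hvw | hwv
  · refine h.of_isChild hvw ?_
    rintro rfl
    simpa using hw.2
  · exact h.tail hwv

lemma child_mem_children (h : IsDescendant o v) (j : Fin (d v.1)) :
    child v j ∈ children (symTree d) o v := by
  have hv := h.dist_add
  have hchild : (symTree d).dist o (child v j) + o.1 = v.1 + 1 :=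
    IsDescendant.dist_add (h.tail ⟨j, rfl⟩)
  exact ⟨Or.inl ⟨j, rfl⟩, by omega⟩

lemma mem_range_child (hv : IsDescendant o v) (hw : IsDescendant o w)
    (hvw : w ∈ children (symTree d) o v) : w ∈ Set.range (child v) := by
  rcases hvw.1 with ⟨j, rfl⟩ | hwv
  · exact ⟨j, rfl⟩
  · have hdist_v := hv.dist_add
    have hdist_w := hw.dist_add
    have hlevel := hwv.level_eq
    have hdist := hvw.2
    omega

open Classical in
/-- The flow that starts at `o` with strength `1 / levelSize d o.1` and splits evenly at every
descendant of `o`. It shows that the branching number from any root `o` is at least the growth rate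
of the level sizes. -/
noncomputable def evenFlow (o v : Vertex d) : ℝ :=
  if IsDescendant o v then (levelSize d v.1 : ℝ)⁻¹ else 0

lemma evenFlow_of_isDescendant (h : IsDescendant o v) : evenFlow o v = (levelSize d v.1 : ℝ)⁻¹ :=
  if_pos h

lemma evenFlow_of_not_isDescendant (h : ¬ IsDescendant o v) : evenFlow o v = 0 :=
  if_neg h

lemma evenFlow_nonneg (o v : Vertex d) : 0 ≤ evenFlow o v := by
  rw [evenFlow]
  split_ifs <;> positivity

lemma evenFlow_self_ne_zero (hd : ∀ n, d n ≠ 0) (o : Vertex d) : evenFlow o o ≠ 0 := by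
  rw [evenFlow_of_isDescendant .refl]
  exact inv_ne_zero (Nat.cast_ne_zero.2 (levelSize_ne_zero hd _))

-- Only descendants of `o` carry flow. This matters at `v = o`, where `children` contains the vertex
-- `parent o`.
lemma indicator_children_evenFlow (hv : IsDescendant o v) :
    (children (symTree d) o v).indicator (evenFlow o) =
      (Set.range (child v)).indicator (evenFlow o) := by
  ext w
  by_cases hw : IsDescendant o w
  · have hiff : w ∈ children (symTree d) o v ↔ w ∈ Set.range (child v) :=
      ⟨mem_range_child hv hw, fun ⟨j, hj⟩ => hj ▸ child_mem_children hv j⟩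
    classical simp only [Set.indicator_apply, hiff]
  · simp only [Set.indicator, evenFlow_of_not_isDescendant hw, ite_self]

lemma sum_evenFlow_child (hd : ∀ n, d n ≠ 0) (hv : IsDescendant o v) :
    ∑ j, evenFlow o (child v j) = evenFlow o v := by
  have hchild (j : Fin (d v.1)) :
      evenFlow o (child v j) = (levelSize d v.1 : ℝ)⁻¹ * (d v.1 : ℝ)⁻¹ := by
    rw [evenFlow_of_isDescendant (hv.tail ⟨j, rfl⟩), child, levelSize_succ, Nat.cast_mul, mul_inv]
  have hdv : (d v.1 : ℝ) ≠ 0 := Nat.cast_ne_zero.2 (hd _)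
  simp only [hchild, sum_const, card_univ, Fintype.card_fin, nsmul_eq_mul,
    evenFlow_of_isDescendant hv]
  field_simp

lemma hasSum_evenFlow (hd : ∀ n, d n ≠ 0) (o v : Vertex d) :
    HasSum (fun w : children (symTree d) o v => evenFlow o w) (evenFlow o v) := by
  by_cases hv : IsDescendant o v
  · change HasSum (evenFlow o ∘ ((↑) : children (symTree d) o v → Vertex d)) _
    rw [hasSum_subtype_iff_indicator, indicator_children_evenFlow hv,
      ← hasSum_subtype_iff_indicator, ← sum_evenFlow_child hd hv]
    exact (child_injective v).hasSum_range_iff.2 (hasSum_fintype _)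
  · rw [evenFlow_of_not_isDescendant hv]
    convert hasSum_zero with w
    exact evenFlow_of_not_isDescendant fun hw => hv (hw.of_mem_children w.2)

lemma isFlow_const_mul_evenFlow {c lam : ℝ} (hd : ∀ n, d n ≠ 0) (hc : 0 ≤ c) (hlam : 1 ≤ lam)
    (hgrowth : ∀ n, c * lam ^ n ≤ levelSize d n) (o : Vertex d) :
    IsFlow (symTree d) o lam fun v => c * evenFlow o v := by
  refine fun v => ⟨mul_nonneg hc (evenFlow_nonneg o v), (hasSum_evenFlow hd o v).mul_left c, ?_⟩
  have : 0 < lam := zero_lt_one.trans_le hlam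
  change c * evenFlow o v ≤ _
  by_cases hv : IsDescendant o v
  · have hsize : (0 : ℝ) < levelSize d v.1 :=
      Nat.cast_pos.2 (Nat.pos_of_ne_zero (levelSize_ne_zero hd _))
    rw [evenFlow_of_isDescendant hv, ← div_eq_mul_inv, div_le_iff₀ hsize, inv_mul_eq_div,
      le_div_iff₀ (by positivity)]
    calc c * lam ^ (symTree d).dist o v
        ≤ c * lam ^ v.1 := by
          gcongr
          exact hv.dist_add ▸ Nat.le_add_right _ _
      _ ≤ levelSize d v.1 := hgrowth v.1
  · rw [evenFlow_of_not_isDescendant hv, mul_zero]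
    positivity

variable {b : ℝ}

lemma exists_isFlow_of_isBigO (hb : 1 ≤ b) (hd : ∀ n, d n ≠ 0)
    (hlow : (fun n => b ^ n) =O[atTop] fun n => (levelSize d n : ℝ)) (o : Vertex d) :
    ∃ f : Vertex d → ℝ, f ≠ 0 ∧ IsFlow (symTree d) o b f := by
  obtain ⟨C, hC, hbound⟩ := bound_of_isBigO_nat_atTop hlow
  refine ⟨fun v => C⁻¹ * evenFlow o v, fun h => ?_,
    isFlow_const_mul_evenFlow hd (inv_nonneg.2 hC.le) hb (fun n => ?_) o⟩
  · exact mul_ne_zero (inv_ne_zero hC.ne') (evenFlow_self_ne_zero hd o) (congrFun h o)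
  · rw [inv_mul_le_iff₀ hC]
    have hn := hbound (Nat.cast_ne_zero.2 (levelSize_ne_zero hd n))
    rw [Real.norm_natCast] at hn
    exact (le_abs_self _).trans hn

lemma ncard_sphere_le_sum_levelSize (o : Vertex d) (n : ℕ) :
    {v | (symTree d).dist o v = n}.ncard ≤ ∑ j ∈ range (o.1 + n + 1), levelSize d j := by
  rw [← card_levelsUpTo, ← Set.ncard_coe_finset]
  exact Set.ncard_le_ncard (sphere_subset_levelsUpTo o n) (finite_toSet _)

lemma exists_ncard_sphere_le {r : ℝ} (hr : 1 < r)
    (hup : (fun n => (levelSize d n : ℝ)) =O[atTop] fun n => r ^ n) (o : Vertex d) :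
    ∃ C : ℝ, ∀ n, {v | (symTree d).dist o v = n}.ncard ≤ C * r ^ n := by
  have hr0 : 0 < r := zero_lt_one.trans hr
  obtain ⟨C, hC, hbound⟩ := bound_of_isBigO_nat_atTop hup
  have hlevel (j : ℕ) : (levelSize d j : ℝ) ≤ C * r ^ j := by
    simpa only [Real.norm_natCast, Real.norm_of_nonneg (pow_nonneg hr0.le j)] using
      hbound (pow_ne_zero j hr0.ne')
  refine ⟨C * r ^ (o.1 + 1) / (r - 1), fun n => ?_⟩
  calc ({v | (symTree d).dist o v = n}.ncard : ℝ)
      ≤ ∑ j ∈ range (o.1 + n + 1), (levelSize d j : ℝ) := by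
        exact_mod_cast ncard_sphere_le_sum_levelSize o n
    _ ≤ ∑ j ∈ range (o.1 + n + 1), C * r ^ j := sum_le_sum fun j _ => hlevel j
    _ = C * ((r ^ (o.1 + n + 1) - 1) / (r - 1)) := by rw [← mul_sum, geom_sum_eq hr.ne']
    _ ≤ C * (r ^ (o.1 + n + 1) / (r - 1)) := by
        have := sub_pos.2 hr
        gcongr
        exact sub_le_self _ zero_le_one
    _ = C * r ^ (o.1 + 1) / (r - 1) * r ^ n := by ring

theorem isBranchingNumber_symTree (hb : 1 ≤ b) (hd : ∀ n, d n ≠ 0)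
    (hlow : (fun n => b ^ n) =O[atTop] fun n => (levelSize d n : ℝ))
    (hup : ∀ r > b, (fun n => (levelSize d n : ℝ)) =O[atTop] fun n => r ^ n) (o : Vertex d) :
    IsBranchingNumber (symTree d) o b := by
  refine IsGreatest.isLUB ⟨⟨hb, exists_isFlow_of_isBigO hb hd hlow o⟩, ?_⟩
  rintro lam ⟨-, f, hf0, hf⟩
  by_contra! hlam
  obtain ⟨r, hbr, hrlam⟩ := exists_between hlam
  have hr : 1 < r := hb.trans_lt hbr
  obtain ⟨C, hC⟩ := exists_ncard_sphere_le hr (hup r hbr) o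
  have hfin (n : ℕ) : {v | (symTree d).dist o v = n}.Finite :=
    (finite_toSet _).subset (sphere_subset_levelsUpTo o n)
  exact hf0 (hf.eq_zero_of_ncard_sphere_le symTree_isTree hfin (by linarith) hrlam hC)

end SphericallySymmetric

section Greedy

/-- The level sizes `N 0 = 1`, `N (n + 1) = N n * ⌈t n / N n⌉` obtained by always choosing the least
number of children for which level `n + 1` has at least `t n` vertices. -/
noncomputable def greedySize (t : ℕ → ℝ) : ℕ → ℕ
  | 0 => 1
  | n + 1 => greedySize t n * ⌈t n / greedySize t n⌉₊

/-- The numbers of children that produce the level sizes `greedySize t`. -/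
noncomputable def greedyOffspring (t : ℕ → ℝ) (n : ℕ) : ℕ := ⌈t n / greedySize t n⌉₊

variable {t : ℕ → ℝ}

lemma levelSize_greedyOffspring (t : ℕ → ℝ) (n : ℕ) :
    levelSize (greedyOffspring t) n = greedySize t n := by
  induction n with
  | zero => rfl
  | succ n ih => rw [levelSize_succ, ih, greedyOffspring, greedySize]

lemma greedySize_pos (ht : ∀ n, 0 < t n) (n : ℕ) : 0 < greedySize t n := by
  induction n with
  | zero => exact Nat.one_pos
  | succ n ih => exact Nat.mul_pos ih (Nat.ceil_pos.2 (div_pos (ht n) (Nat.cast_pos.2 ih)))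

lemma greedyOffspring_ne_zero (ht : ∀ n, 0 < t n) (n : ℕ) : greedyOffspring t n ≠ 0 :=
  (Nat.ceil_pos.2 (div_pos (ht n) (Nat.cast_pos.2 (greedySize_pos ht n)))).ne'

lemma le_greedySize_succ (ht : ∀ n, 0 < t n) (n : ℕ) : t n ≤ greedySize t (n + 1) := by
  have hpos : (0 : ℝ) < greedySize t n := Nat.cast_pos.2 (greedySize_pos ht n)
  rw [greedySize, Nat.cast_mul, ← div_le_iff₀' hpos]
  exact Nat.le_ceil _

lemma greedySize_succ_le (ht : ∀ n, 0 < t n) (n : ℕ) :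
    greedySize t (n + 1) ≤ t n + greedySize t n := by
  have hpos : (0 : ℝ) < greedySize t n := Nat.cast_pos.2 (greedySize_pos ht n)
  calc (greedySize t (n + 1) : ℝ)
      = greedySize t n * ⌈t n / greedySize t n⌉₊ := by rw [greedySize, Nat.cast_mul]
    _ ≤ greedySize t n * (t n / greedySize t n + 1) := by
        gcongr
        exact (Nat.ceil_lt_add_one (div_pos (ht n) hpos).le).le
    _ = t n + greedySize t n := by field_simp

variable {b C : ℝ}

lemma greedySize_geometric_le (hb : 1 ≤ b) (hC : 1 ≤ C) (n : ℕ) :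
    greedySize (fun i => C * b ^ i) n ≤ C * ((n + 1) * b ^ n) := by
  have ht (i : ℕ) : 0 < C * b ^ i := by positivity
  induction n with
  | zero => simpa [greedySize] using hC
  | succ n ih =>
    calc (greedySize (fun i => C * b ^ i) (n + 1) : ℝ)
        ≤ C * b ^ n + C * ((n + 1) * b ^ n) := (greedySize_succ_le ht n).trans (by gcongr)
      _ = C * ((n + 1 + 1) * b ^ n) := by ring
      _ ≤ C * (((n + 1 : ℕ) + 1) * b ^ (n + 1)) := by
          push_cast
          gcongr
          exact n.le_succ

lemma isBigO_pow_greedySize (hb : 1 ≤ b) (hC : 1 ≤ C) :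
    (fun n => b ^ n) =O[atTop] fun n => (greedySize (fun i => C * b ^ i) n : ℝ) := by
  have ht (i : ℕ) : 0 < C * b ^ i := by positivity
  refine IsBigO.of_bound b (eventually_atTop.2 ⟨1, fun n hn => ?_⟩)
  obtain ⟨n, rfl⟩ := Nat.exists_eq_add_of_le' hn
  rw [Real.norm_of_nonneg (by positivity), Real.norm_natCast, pow_succ']
  gcongr
  exact (le_mul_of_one_le_left (by positivity) hC).trans (le_greedySize_succ ht n)

lemma isBigO_greedySize_pow (hb : 1 ≤ b) (hC : 1 ≤ C) {r : ℝ} (hr : b < r) :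
    (fun n => (greedySize (fun i => C * b ^ i) n : ℝ)) =O[atTop] fun n => r ^ n := by
  have hnorm : ‖b‖ < r := by rwa [Real.norm_of_nonneg (zero_le_one.trans hb)]
  have hpoly : (fun n : ℕ => ((n : ℝ) + 1) * b ^ n) =O[atTop] fun n => r ^ n := by
    simpa only [pow_one, pow_zero, ← add_mul] using
      (isLittleO_pow_const_mul_const_pow_const_pow_of_norm_lt 1 hnorm).isBigO.add
        (isLittleO_pow_const_mul_const_pow_const_pow_of_norm_lt 0 hnorm).isBigO
  refine (IsBigO.of_bound C (Eventually.of_forall fun n => ?_)).trans hpoly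
  rw [Real.norm_natCast, Real.norm_of_nonneg (by positivity)]
  exact greedySize_geometric_le hb hC n

end Greedy

theorem exists_isTree_isBranchingNumber {b : ℝ} (hb : 1 ≤ b) {m : ℕ} (hm : m ≠ 0) :
    ∃ (V : Type) (_ : Countable V) (G : SimpleGraph V), G.IsTree ∧ Infinite V ∧
      (∀ v, (G.neighborSet v).Finite) ∧ (∀ o, IsBranchingNumber G o b) ∧
      ∃ c, (G.neighborSet c).ncard = m := by
  have hm1 : (1 : ℝ) ≤ m := Nat.one_le_cast.2 (Nat.one_le_iff_ne_zero.2 hm)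
  let d := greedyOffspring fun i => m * b ^ i
  have hd (n : ℕ) : d n ≠ 0 := greedyOffspring_ne_zero (fun i => by positivity) n
  have hroot : d 0 = m := by simp [d, greedyOffspring, greedySize]
  refine ⟨Vertex d, inferInstance, symTree d, symTree_isTree, infinite_vertex hd,
    symTree_neighborSet_finite, isBranchingNumber_symTree hb hd ?_ fun r hr => ?_,
    root d, (ncard_neighborSet_root d).trans hroot⟩
  · simpa only [d, levelSize_greedyOffspring] using isBigO_pow_greedySize hb hm1
  · simpa only [d, levelSize_greedyOffspring] using isBigO_greedySize_pow hb hm1 hr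

section Independence

variable {ι : Type*} {E : ι → Type*} [∀ i, MeasurableSpace (E i)]

-- Freezing the coordinates outside `s` does not change `f`.
lemma measurable_of_dependsOn {β : Type*} [MeasurableSpace β] [Nonempty (∀ i, E i)]
    {f : (∀ i, E i) → β} (hf : Measurable f) {s : Set ι} (hs : DependsOn f s) :
    Measurable[⨆ i ∈ s, MeasurableSpace.comap (Function.eval i) inferInstance] f := by
  classical
  obtain ⟨x₀⟩ := ‹Nonempty (∀ i, E i)›
  have hfreeze : f = f ∘ fun x => s.piecewise x x₀ :=
    funext fun x => hs fun i hi => (s.piecewise_eq_of_mem x x₀ hi).symm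
  rw [hfreeze]
  refine hf.comp (@measurable_pi_lambda _ _ _ (_) _ _ fun i => ?_)
  by_cases hi : i ∈ s
  · simp only [Set.piecewise_eq_of_mem _ _ _ hi]
    exact measurable_iff_comap_le.2 (le_iSup₂_of_le i hi le_rfl)
  · simp only [Set.piecewise_eq_of_notMem _ _ _ hi]
    exact measurable_const

variable (μ : ∀ i, Measure (E i)) [∀ i, IsProbabilityMeasure (μ i)]

lemma indepFun_infinitePi_of_dependsOn {β γ : Type*} [MeasurableSpace β] [MeasurableSpace γ]
    {f : (∀ i, E i) → β} {g : (∀ i, E i) → γ} (hf : Measurable f) (hg : Measurable g)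
    {s t : Set ι} (hs : DependsOn f s) (ht : DependsOn g t) (hst : Disjoint s t) :
    IndepFun f g (Measure.infinitePi μ) := by
  have : Nonempty (∀ i, E i) := (Measure.infinitePi μ).nonempty_of_neZero
  have hcoord : iIndepFun (fun i (x : ∀ i, E i) => x i) (Measure.infinitePi μ) :=
    iIndepFun_infinitePi (X := fun _ => id) fun _ => measurable_id
  have hindep := indep_iSup_of_disjoint
    (fun i => (measurable_pi_apply (X := E) i).comap_le) hcoord hst
  exact indep_of_indep_of_le_left
    (indep_of_indep_of_le_right hindep (measurable_of_dependsOn hg ht).comap_le)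
    (measurable_of_dependsOn hf hs).comap_le

lemma isKIndependent_infinitePi_of_dependsOn {V : Type*} {G : SimpleGraph V} {k : ℕ}
    {Z : (∀ i, E i) → V → Bool} (hZ : Measurable Z) (N : V → Set ι)
    (hN : ∀ v, DependsOn (fun x => Z x v) (N v))
    (hdisj : ∀ u v, k < G.dist u v → Disjoint (N u) (N v)) :
    IsKIndependent G k (Measure.infinitePi μ) Z := by
  have hmeas (A : Set V) : Measurable fun x (v : A) => Z x v :=
    measurable_pi_lambda _ fun v => (measurable_pi_apply (v : V)).comp hZ
  have hdep (A : Set V) : DependsOn (fun x (v : A) => Z x v) (⋃ v ∈ A, N v) := fun x y h =>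
    funext fun v => hN v fun i hi => h i (Set.mem_biUnion v.2 hi)
  intro U W hUW
  refine indepFun_infinitePi_of_dependsOn μ (hmeas U) (hmeas W) (hdep U) (hdep W) ?_
  simp only [Set.disjoint_iUnion_left, Set.disjoint_iUnion_right]
  exact fun w hw u hu => hdisj u w (hUW u hu w hw)

end Independence

section Domination

variable {V : Type*}

lemma StochDominates.measure_le_of_isUpperSet {μ ν : Measure (V → Bool)} (h : StochDominates μ ν)
    {A : Set (V → Bool)} (hA : MeasurableSet A) (hup : IsUpperSet A) : ν A ≤ μ A := by
  obtain ⟨π, rfl, rfl, hle⟩ := h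
  rw [Measure.map_apply measurable_snd hA, Measure.map_apply measurable_fst hA]
  exact measure_mono_ae (hle.mono fun x hx hxA => hup hx hxA)

lemma isUpperSet_forall_mem_eq_true (S : Finset V) :
    IsUpperSet {ω : V → Bool | ∀ s ∈ S, ω s = true} := fun _ _ hle hω s hs =>
  Bool.eq_true_of_true_le ((hω s hs).symm.le.trans (hle s))

lemma measurableSet_forall_mem_eq_true (S : Finset V) :
    MeasurableSet {ω : V → Bool | ∀ s ∈ S, ω s = true} :=
  MeasurableSet.pi S.countable_toSet fun _ _ => measurableSet_singleton true

instance (q : unitInterval) : IsProbabilityMeasure (bernoulliField V q) :=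
  inferInstanceAs (IsProbabilityMeasure (Measure.infinitePi _))

lemma bernoulliField_forall_mem_eq_true (q : unitInterval) (S : Finset V) :
    bernoulliField V q {ω | ∀ s ∈ S, ω s = true} = ENNReal.ofReal q ^ #S := by
  have hsite : bernoulliMeasure true false q {true} = ENNReal.ofReal q := by
    rw [bernoulliMeasure_apply_of_mem_of_notMem q (measurableSet_singleton _) rfl (by simp),
      ENNReal.ofReal]
    exact congrArg _ (Real.toNNReal_of_nonneg q.2.1).symm
  have hpi : {ω : V → Bool | ∀ s ∈ S, ω s = true} = Set.pi S fun _ => {true} := rfl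
  rw [hpi, bernoulliField, Measure.infinitePi_pi _ fun _ _ => measurableSet_singleton _,
    prod_const, hsite]

lemma measurableSet_le [Countable V] :
    MeasurableSet {x : (V → Bool) × (V → Bool) | x.2 ≤ x.1} := by
  simp only [Pi.le_def, Set.ofPred_forall]
  refine MeasurableSet.iInter fun v => ?_
  have hv : Measurable fun x : (V → Bool) × (V → Bool) => (x.2 v, x.1 v) := by fun_prop
  exact hv (Set.toFinite {y : Bool × Bool | y.1 ≤ y.2}).measurableSet

lemma stochDominates_bernoulliField_zero [Countable V] (μ : Measure (V → Bool))
    [IsProbabilityMeasure μ] : StochDominates μ (bernoulliField V 0) := by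
  have hclosed : bernoulliField V 0 = Measure.dirac fun _ => false := by
    simp [bernoulliField]
  have hpair : Measurable fun ω : V → Bool => (ω, fun _ : V => false) :=
    measurable_id.prodMk measurable_const
  refine ⟨μ.map fun ω => (ω, fun _ => false), ?_, ?_, ?_⟩
  · rw [Measure.map_map measurable_fst hpair]
    exact Measure.map_id
  · rw [Measure.map_map measurable_snd hpair, hclosed]
    exact (Measure.map_const μ _).trans (by rw [measure_univ, one_smul])
  · exact (ae_map_iff hpair.aemeasurable measurableSet_le).2
      (Eventually.of_forall fun ω v => Bool.false_le _)

lemma StochDominates.eq_zero_of_forall_mem_eq_true_null {μ : Measure (V → Bool)}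
    {q : unitInterval} (h : StochDominates μ (bernoulliField V q)) {S : Finset V}
    (hS : S.Nonempty) (hnull : μ {ω | ∀ s ∈ S, ω s = true} = 0) : q = 0 := by
  have hle := h.measure_le_of_isUpperSet (measurableSet_forall_mem_eq_true S)
    (isUpperSet_forall_mem_eq_true S)
  rw [hnull, bernoulliField_forall_mem_eq_true, nonpos_iff_eq_zero,
    pow_eq_zero_iff hS.card_ne_zero, ENNReal.ofReal_eq_zero] at hle
  exact Subtype.ext (le_antisymm hle q.2.1)

end Domination

section Star

variable {V : Type*} {c v : V} {S : Finset V} {ω : V → Bool}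

open Classical in
/-- The configuration that agrees with `ω` off the site `c`, and in which `c` is open exactly when
some site of `S` is closed in `ω`. Under a Bernoulli field it is the percolation that dominates no
Bernoulli field with positive parameter. -/
noncomputable def starField (c : V) (S : Finset V) (ω : V → Bool) : V → Bool :=
  Function.update ω c (decide (∃ s ∈ S, ω s = false))

lemma starField_center : starField c S ω c = true ↔ ∃ s ∈ S, ω s = false := by
  classical
  rw [starField, Function.update_self, decide_eq_true_iff]

lemma starField_of_ne (h : v ≠ c) : starField c S ω v = ω v := by
  classical exact Function.update_of_ne h _ _

lemma preimage_starField_center :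
    (starField c S · c) ⁻¹' {true} = {ω | ∀ s ∈ S, ω s = true}ᶜ := by
  ext ω
  simp [starField_center]

lemma measurable_starField (c : V) (S : Finset V) : Measurable (starField c S) := by
  refine measurable_pi_iff.2 fun v => ?_
  by_cases hv : v = c
  · subst hv
    refine measurable_to_bool ?_
    rw [preimage_starField_center]
    exact (measurableSet_forall_mem_eq_true S).compl
  · simp only [starField_of_ne hv]
    exact measurable_pi_apply v

lemma isSitePercolation_starField (c : V) (S : Finset V) {x : unitInterval}
    (hx : (x : ℝ) + (x : ℝ) ^ #S = 1) :
    IsSitePercolation (bernoulliField V x) (starField c S) x := by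
  refine ⟨measurable_starField c S, fun v => ?_⟩
  by_cases hv : v = c
  · subst hv
    have hprob : 1 - ENNReal.ofReal x ^ #S = ENNReal.ofReal x := by
      rw [← ENNReal.ofReal_pow x.2.1, ← ENNReal.ofReal_one,
        ← ENNReal.ofReal_sub _ (pow_nonneg x.2.1 _), ← hx, add_sub_cancel_right]
    rw [← hprob, ← bernoulliField_forall_mem_eq_true,
      ← prob_compl_eq_one_sub (measurableSet_forall_mem_eq_true S), ← preimage_starField_center]
    rfl
  · simpa [starField_of_ne hv] using bernoulliField_forall_mem_eq_true x {v}

open Classical in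
lemma dependsOn_starField (c : V) (S : Finset V) (v : V) :
    DependsOn (fun ω => starField c S ω v)
      (Function.update (fun u : V => ({u} : Set V)) c (S : Set V) v) := by
  intro ω ω' h
  by_cases hv : v = c
  · subst hv
    rw [Function.update_self] at h
    rw [Bool.eq_iff_iff, starField_center, starField_center]
    exact exists_congr fun s => and_congr_right fun hs => by rw [h s hs]
  · rw [Function.update_of_ne hv] at h
    simpa only [starField_of_ne hv] using h v rfl

lemma isKIndependent_starField {G : SimpleGraph V} {k : ℕ} (hk : 1 ≤ k)
    (hS : ∀ s ∈ S, G.Adj c s) (x : unitInterval) :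
    IsKIndependent G k (bernoulliField V x) (starField c S) := by
  classical
  have notMem_of_lt {v : V} (hv : k < G.dist c v) : v ∉ S := fun hvS => by
    rw [SimpleGraph.dist_eq_one_iff_adj.2 (hS v hvS)] at hv
    omega
  refine isKIndependent_infinitePi_of_dependsOn _ (measurable_starField c S) _
    (dependsOn_starField c S) fun u v huv => ?_
  have hne : u ≠ v := by
    rintro rfl
    simp at huv
  by_cases hu : u = c
  · subst hu
    rw [Function.update_self, Function.update_of_ne hne.symm, Set.disjoint_singleton_right]
    exact notMem_of_lt huv
  · rw [Function.update_of_ne hu]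
    by_cases hv : v = c
    · subst hv
      rw [Function.update_self, Set.disjoint_singleton_left]
      exact notMem_of_lt (SimpleGraph.dist_comm ▸ huv)
    · rwa [Function.update_of_ne hv, Set.disjoint_singleton]

open Classical in
lemma exists_starField_eq_false (hc : c ∉ S) (ω : V → Bool) :
    ∃ s ∈ insert c S, starField c S ω s = false := by
  by_cases h : ∃ s ∈ S, ω s = false
  · obtain ⟨s, hs, hωs⟩ := h
    exact ⟨s, mem_insert_of_mem hs, by rwa [starField_of_ne (ne_of_mem_of_not_mem hs hc)]⟩
  · exact ⟨c, mem_insert_self c S, Bool.eq_false_iff.2 (mt starField_center.1 h)⟩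

lemma eq_zero_of_stochDominates_map_starField (hc : c ∉ S) (P : Measure (V → Bool))
    {q : unitInterval} (h : StochDominates (P.map (starField c S)) (bernoulliField V q)) :
    q = 0 := by
  classical
  refine h.eq_zero_of_forall_mem_eq_true_null (insert_nonempty c S) ?_
  have hempty : starField c S ⁻¹' {ω | ∀ s ∈ insert c S, ω s = true} = ∅ := by
    refine Set.eq_empty_of_forall_notMem fun ω hω => ?_
    obtain ⟨s, hs, hfalse⟩ := exists_starField_eq_false hc ω
    exact Bool.false_ne_true (hfalse.symm.trans (hω s hs))
  rw [Measure.map_apply (measurable_starField c S) (measurableSet_forall_mem_eq_true _), hempty,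
    measure_empty]

end Star

lemma exists_add_pow_eq_one {p : ℝ} (hp1 : p < 1) {m : ℕ} (hm : p ^ m ≤ 1 - p) :
    ∃ x, p ≤ x ∧ x < 1 ∧ x + x ^ m = 1 := by
  obtain ⟨x, hx, hsum⟩ := intermediate_value_Icc (f := fun x : ℝ => x + x ^ m) hp1.le
    (by fun_prop) (show (1 : ℝ) ∈ _ from ⟨by linarith, by simp⟩)
  refine ⟨x, hx.1, lt_of_le_of_ne hx.2 ?_, hsum⟩
  rintro rfl
  simp at hsum

theorem exists_isKIndependent_stochDominates_iff_eq_zero {V : Type*} [Countable V]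
    {G : SimpleGraph V} {c : V} (hfin : (G.neighborSet c).Finite) {k : ℕ} (hk : 1 ≤ k) {p : ℝ}
    (hp0 : 0 ≤ p) (hp1 : p < 1) (hp : p ^ (G.neighborSet c).ncard ≤ 1 - p) :
    ∃ x : unitInterval, p ≤ x ∧ (x : ℝ) < 1 ∧ ∃ Z : (V → Bool) → V → Bool,
      IsSitePercolation (bernoulliField V x) Z x ∧ IsKIndependent G k (bernoulliField V x) Z ∧
      ∀ q, StochDominates ((bernoulliField V x).map Z) (bernoulliField V q) ↔ q = 0 := by
  obtain ⟨x, hpx, hx1, hx⟩ := exists_add_pow_eq_one hp1 hp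
  rw [Set.ncard_eq_toFinset_card _ hfin] at hx
  let S := hfin.toFinset
  have hS (s : V) : s ∈ S ↔ G.Adj c s := hfin.mem_toFinset
  let x' : unitInterval := ⟨x, hp0.trans hpx, hx1.le⟩
  refine ⟨x', hpx, hx1, starField c S, isSitePercolation_starField c S hx,
    isKIndependent_starField hk (fun s => (hS s).1) x', fun q => ⟨?_, ?_⟩⟩
  · exact eq_zero_of_stochDominates_map_starField (fun hc => G.irrefl ((hS c).1 hc)) _
  · rintro rfl
    have := Measure.isProbabilityMeasure_map (μ := bernoulliField V x')
      (measurable_starField c S).aemeasurable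
    exact stochDominates_bernoulliField_zero _

end TreePercolation

theorem mainTheorem8 (k : ℕ) (hk : 1 ≤ k) (p : ℝ) (hp0 : 0 ≤ p) (hp1 : p < 1)
    (b : ℝ) (hb : 1 ≤ b) :
    ∃ p' : ℝ, p ≤ p' ∧ p' < 1 ∧
      ∃ (V : Type) (G : SimpleGraph V),
        G.IsTree ∧ Infinite V ∧ (∀ v, (G.neighborSet v).Finite) ∧
        (∀ o, TreePercolation.IsBranchingNumber G o b) ∧
        ∃ (Ω : Type) (_ : MeasurableSpace Ω) (P : Measure Ω) (_ : IsProbabilityMeasure P)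
          (Z : Ω → V → Bool),
          TreePercolation.IsSitePercolation P Z p' ∧
          TreePercolation.IsKIndependent G k P Z ∧
          ∀ q : unitInterval,
            TreePercolation.StochDominates (P.map Z) (TreePercolation.bernoulliField V q) ↔
              q = 0 := by
  obtain ⟨m, hm0, hmp⟩ : ∃ m : ℕ, m ≠ 0 ∧ p ^ m ≤ 1 - p :=
    ((Filter.eventually_ne_atTop 0).and
      ((tendsto_pow_atTop_nhds_zero_of_lt_one hp0 hp1).eventually_le_const
        (sub_pos.2 hp1))).exists
  obtain ⟨V, _, G, hG, hinf, hfin, hbranch, c, rfl⟩ :=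
    TreePercolation.exists_isTree_isBranchingNumber hb hm0
  obtain ⟨x, hpx, hx1, Z, hsite, hindep, hdom⟩ :=
    TreePercolation.exists_isKIndependent_stochDominates_iff_eq_zero (hfin c) hk hp0 hp1 hmp
  exact ⟨x, hpx, hx1, V, G, hG, hinf, hfin, hbranch, V → Bool, inferInstance,
    TreePercolation.bernoulliField V x, inferInstance, Z, hsite, hindep, hdom⟩
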